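/- Let $\mathcal X$ and $\Theta$ be measurable spaces, let $X_1, X_2, \ldots$ be i.i.d. random variables with values in $\mathcal X$, let $f : \Theta\times\mathcal X \to [0,1]$ be measurable, and put $\mu_\theta = \mathbb E[f(\theta, X_1)]$. For $n \in \mathbb N$ and $\theta \in \Theta$ let $$\psi_n^\star(\theta,\mu_\theta) = \max_{\lambda \in \left[-\frac{1}{1-\mu_\theta}, \frac{1}{\mu_\theta}\right]} \sum_{i=1}^n \ln\bigl(1+\lambda (f(\theta,X_i)-\mu_\theta)\bigr) \in [0,\infty]$$ be the optimal log-wealth, where $\ln 0 = -\infty$, and where for $\mu_\theta \in \{0,1\}$ the end point with vanishing denominator is infinite and the maximum is a supremum over the finite $\lambda$ in the interval. Let $P_0$ be a probability measure on $\Theta$ that does not depend on the data, and let $\delta \in (0,1]$. Then, with $P_n = P(X_1,\dots,X_n)$ for a probability kernel $P$ from $\mathcal X^n$ to $\Theta$, $$\Pr\left\{\exists\, n \in \mathbb N,\ \exists\, P \text{ a probability kernel from } \mathcal X^n \text{ to } \Theta :\ \int \psi_n^\star(\theta,\mu_\theta)\, dP_n(\theta) - \mathrm{KL}(P_n\|P_0)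 - \ln\frac{\sqrt\pi\,\Gamma(n+1)}{\Gamma(n+\frac12)} \ge \ln\frac1\delta\right\} \le \delta .$$ Here $\mathrm{KL}(P_n\|P_0) = \int \ln\frac{dP_n}{dP_0}\, dP_n$ if $P_n \ll P_0$, and $\mathrm{KL}(P_n\|P_0)=\infty$ otherwise; when $\mathrm{KL}(P_n\|P_0)=\infty$ the left-hand side of the inequality is $-\infty$. If the event is not measurable, $\Pr$ denotes outer probability. Equivalently, with probability at least $1-\delta$, simultaneously for all $n$ and all data-dependent posteriors $P_n$ with $\mathrm{KL}(P_n\|P_0)<\infty$, $\int \psi_n^\star\, dP_n < \mathrm{KL}(P_n\|P_0) + \ln\frac{\sqrt\pi\,\Gamma(n+1)}{\Gamma(n+1/2)} + \ln\frac1\delta$. -/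

import Mathlib

open MeasureTheory ProbabilityTheory InformationTheory
open scoped ENNReal

noncomputable section

/-- The admissible betting fractions `l ∈ [-1/(1-m), 1/m]`, with the denominators cleared, so that
an end point with a vanishing denominator is infinite: `[-1, ∞)` for `m = 0` and `(-∞, 1]` for
`m = 1`. -/
def betRange (m : ℝ) : Set ℝ := {l : ℝ | -1 ≤ l * (1 - m) ∧ l * m ≤ 1}

theorem betRange_eq_Icc {m : ℝ} (h0 : 0 < m) (h1 : m < 1) :
    betRange m = Set.Icc (-(1 / (1 - m))) (1 / m) := by
  have h2 : 0 < 1 - m := sub_pos.2 h1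
  ext l
  simp only [betRange, Set.mem_ofPred_eq, Set.mem_Icc, le_div_iff₀ h0, ← neg_div, div_le_iff₀ h2]

theorem betRange_zero : betRange 0 = Set.Ici (-1) := by
  ext l; simp [betRange]

theorem betRange_one : betRange 1 = Set.Iic 1 := by
  ext l; simp [betRange]

/-- The log-wealth `∑ i, ln (1 + l * (y i - m))` of the constant betting fraction `l` against the
observations `y`, in the extended reals, where `ln 0 = -∞` (for `m ∈ [0, 1]`, `l ∈ betRange m` and
`y i ∈ [0, 1]` the arguments of the logarithm are nonnegative). -/
def logWealth {n : ℕ} (y : Fin n → ℝ) (m l : ℝ) : EReal :=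
  ∑ i, ENNReal.log (ENNReal.ofReal (1 + l * (y i - m)))

/-- The optimal log-wealth: the largest log-wealth of an admissible betting fraction. -/
def optLogWealth {n : ℕ} (y : Fin n → ℝ) (m : ℝ) : EReal :=
  ⨆ l ∈ betRange m, logWealth y m l

theorem optLogWealth_nonneg {n : ℕ} (y : Fin n → ℝ) (m : ℝ) : 0 ≤ optLogWealth y m := by
  refine le_iSup₂_of_le (0 : ℝ) (by simp [betRange]) ?_
  simp [logWealth]

theorem logWealth_eq_log_prod {n : ℕ} (y : Fin n → ℝ) (m l : ℝ) :
    logWealth y m l = ENNReal.log (∏ i, ENNReal.ofReal (1 + l * (y i - m))) := by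
  unfold logWealth
  induction (Finset.univ : Finset (Fin n)) using Finset.induction_on with
  | empty => simp
  | insert a s ha ih => rw [Finset.sum_insert ha, Finset.prod_insert ha, ENNReal.log_mul_add, ih]

/-- The supremum in the definition of the optimal log-wealth is a maximum. -/
theorem exists_optLogWealth_eq {n : ℕ} (y : Fin n → ℝ) {m : ℝ} (h0 : 0 < m) (h1 : m < 1) :
    ∃ l ∈ Set.Icc (-(1 / (1 - m))) (1 / m), optLogWealth y m = logWealth y m l := by
  have h2 : 0 < 1 - m := sub_pos.2 h1
  have hne : (Set.Icc (-(1 / (1 - m))) (1 / m)).Nonempty :=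
    ⟨0, neg_nonpos.2 (by positivity), by positivity⟩
  have hc : Continuous fun l : ℝ => logWealth y m l := by
    simp only [logWealth_eq_log_prod]
    refine ENNReal.continuous_log.comp ?_
    have : ∀ s : Finset (Fin n), Continuous fun l : ℝ =>
        ((∏ i ∈ s, (1 + l * (y i - m)).toNNReal : NNReal) : ℝ≥0∞) := fun s =>
      ENNReal.continuous_coe.comp
        (continuous_finsetProd s fun i _ => continuous_real_toNNReal.comp (by fun_prop))
    simpa [ENNReal.ofReal] using this Finset.univ
  obtain ⟨l, hl, hmax⟩ := isCompact_Icc.exists_isMaxOn hne hc.continuousOn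
  refine ⟨l, hl, le_antisymm ?_ ?_⟩
  · exact iSup₂_le fun k hk => hmax (betRange_eq_Icc h0 h1 ▸ hk)
  · exact le_iSup₂ (f := fun l _ => logWealth y m l) l ((betRange_eq_Icc h0 h1).symm ▸ hl)

end

noncomputable section

/-! Fix `θ` and put `b = m(1 + λ(1 - m))`. Then `1 + λ(y - m) = b·y/m + (1 - b)·(1 - y)/(1 - m)`, so
betting is investing in two assets. The Beta(1/2, 1/2) mixture of constant portfolios loses at most
the factor `c = √π Γ(n+1)/Γ(n+1/2)` to the best one in hindsight (`prod_portfolio_le_lintegral`).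
Hence `ψ* ≤ log (c W θ)`, where `W θ` is the mixture wealth.

Every constant portfolio has wealth factors of mean at most 1. Averaging also over the data-free
`P₀` gives a nonnegative supermartingale `M` started at 1, and Ville's inequality bounds by `δ` the
probability that it ever reaches `1/δ` (`mul_measure_exists_le_mixtureWealth_le_one`). By
Donsker-Varadhan (`lintegral_log_le_klDiv_add`), `∫ log (c W) dPₙ ≤ KL + log c + log M`. This holds
for every outcome, every `n` and every posterior, so the bad event lies inside Ville's event and no
union bound is needed. -/

/-! ### Binomial likelihoods and Gamma functions -/

theorem monotoneOn_add_one_mul_log_sub :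
    MonotoneOn (fun x : ℝ => (x + 1) * Real.log (x + 1) - x * Real.log x - Real.log (x + 1 / 2))
      (Set.Ici 0) := by
  have hd : ∀ x : ℝ, 0 < x → HasDerivAt
      (fun x : ℝ => (x + 1) * Real.log (x + 1) - x * Real.log x - Real.log (x + 1 / 2))
      (Real.log (x + 1) + 1 - (Real.log x + 1) - 1 / (x + 1 / 2)) x := by
    intro x hx
    have h1 : HasDerivAt (fun x : ℝ => (x + 1) * Real.log (x + 1)) (Real.log (x + 1) + 1) x := by
      simpa using (Real.hasDerivAt_mul_log (x := x + 1) (by positivity)).comp_add_const x 1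
    have h2 : HasDerivAt (fun x : ℝ => Real.log (x + 1 / 2)) (1 / (x + 1 / 2)) x :=
      ((hasDerivAt_id x).add_const (1 / 2)).log (by simp only [id]; positivity)
    exact (h1.sub (Real.hasDerivAt_mul_log hx.ne')).sub h2
  refine monotoneOn_of_deriv_nonneg (convex_Ici 0) ?_ ?_ ?_
  · refine ContinuousOn.sub (Continuous.continuousOn ?_) ?_
    · exact (Real.continuous_mul_log.comp (continuous_id.add continuous_const)).sub
        Real.continuous_mul_log
    · refine ContinuousOn.log (by fun_prop) fun x hx => ?_
      have : (0 : ℝ) ≤ x := hx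
      positivity
  · rw [interior_Ici]
    exact fun x hx => (hd x hx).differentiableAt.differentiableWithinAt
  · rw [interior_Ici]
    intro x hx
    have hx : 0 < x := hx
    rw [(hd x hx).deriv]
    -- The bound `2u/(u+2) ≤ log (1+u)` at `u = 1/x` is exactly nonnegativity of the derivative.
    have h := Real.le_log_one_add_of_nonneg (x := 1 / x) (by positivity)
    have e1 : 1 + 1 / x = (x + 1) / x := by field_simp
    have e2 : 2 * (1 / x) / (1 / x + 2) = 1 / (x + 1 / 2) := by field_simp; ring
    rw [e1, e2, Real.log_div (by positivity) hx.ne'] at h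
    linarith

/-- Equality holds at `j = 0`. Passing from `j` to `j + 1` increases right minus left by the
difference of the function in `monotoneOn_add_one_mul_log_sub` between `k + j` and `j`. -/
theorem log_Gamma_add_half_add_le (k j : ℕ) :
    k * Real.log k + j * Real.log j - ((k + j : ℕ) : ℝ) * Real.log ((k + j : ℕ) : ℝ) ≤
      Real.log (Real.Gamma (k + 1 / 2)) + Real.log (Real.Gamma (j + 1 / 2))
        - Real.log (Real.sqrt Real.pi) - Real.log (Real.Gamma ((k + j : ℕ) + 1 / 2)) := by
  have step : ∀ i : ℕ, Real.log (Real.Gamma ((i + 1 : ℕ) + 1 / 2)) =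
      Real.log ((i : ℝ) + 1 / 2) + Real.log (Real.Gamma (i + 1 / 2)) := by
    intro i
    have hi : (0 : ℝ) < i + 1 / 2 := by positivity
    rw [← Real.log_mul hi.ne' (Real.Gamma_pos_of_pos hi).ne', ← Real.Gamma_add_one hi.ne']
    congr 2; push_cast; ring
  induction j with
  | zero => simp [Real.Gamma_one_half_eq, -one_div]
  | succ j ih =>
    have h := monotoneOn_add_one_mul_log_sub (a := (j : ℝ)) (b := ((k + j : ℕ) : ℝ))
      (Set.mem_Ici.2 (Nat.cast_nonneg _)) (Set.mem_Ici.2 (Nat.cast_nonneg _))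
      (by exact_mod_cast Nat.le_add_left j k)
    have h1 := step j
    have h2 := step (k + j)
    rw [← add_assoc, h1, h2]
    simp only at h
    have e1 : ((k + j + 1 : ℕ) : ℝ) = ((k + j : ℕ) : ℝ) + 1 := by push_cast; ring
    have e2 : ((j + 1 : ℕ) : ℝ) = (j : ℝ) + 1 := by push_cast; ring
    rw [e1, e2]
    linarith

/-- This is `log x ≤ x - 1` at `x = bn/k`. For `b` and `1 - b` with `n = k + j` the linear terms
cancel in the product, leaving the maximum likelihood `k^k j^j / n^n` without any optimisation over
`b`. -/
theorem pow_le_exp_of_nonneg {b n : ℝ} (hb : 0 ≤ b) (hn : 0 < n) (k : ℕ) :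
    b ^ k ≤ Real.exp (b * n - k + k * Real.log k - k * Real.log n) := by
  rcases Nat.eq_zero_or_pos k with rfl | hk
  · simpa using mul_nonneg hb hn.le
  rcases hb.eq_or_lt with rfl | hb
  · rw [zero_pow hk.ne']; positivity
  have hk' : (0 : ℝ) < k := Nat.cast_pos.2 hk
  rw [← Real.exp_log (pow_pos hb k), Real.exp_le_exp, Real.log_pow]
  have h := Real.log_le_sub_one_of_pos (x := b * n / k) (by positivity)
  rw [Real.log_div (by positivity) hk'.ne', Real.log_mul hb.ne' hn.ne'] at h
  have h2 := mul_le_mul_of_nonneg_left h hk'.le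
  have e : (k : ℝ) * (b * n / k - 1) = b * n - k := by field_simp
  rw [e] at h2
  linarith

theorem pow_mul_one_sub_pow_le_Gamma {b : ℝ} (h0 : 0 ≤ b) (h1 : b ≤ 1) (k j : ℕ) :
    b ^ k * (1 - b) ^ j ≤ Real.Gamma (k + 1 / 2) * Real.Gamma (j + 1 / 2) /
      (Real.sqrt Real.pi * Real.Gamma ((k + j : ℕ) + 1 / 2)) := by
  have hG : ∀ i : ℕ, 0 < Real.Gamma ((i : ℝ) + 1 / 2) := fun i =>
    Real.Gamma_pos_of_pos (by positivity)
  have hpi : 0 < Real.sqrt Real.pi := Real.sqrt_pos.2 Real.pi_pos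
  rcases Nat.eq_zero_or_pos (k + j) with h | h
  · obtain ⟨rfl, rfl⟩ : k = 0 ∧ j = 0 := by omega
    have := (hG 0).ne'
    simp only [Nat.cast_zero, zero_add, Real.Gamma_one_half_eq] at this ⊢
    simp [this]
  have hn : (0 : ℝ) < (k + j : ℕ) := Nat.cast_pos.2 h
  have hA := mul_le_mul (pow_le_exp_of_nonneg h0 hn k)
    (pow_le_exp_of_nonneg (sub_nonneg.2 h1) hn j) (pow_nonneg (sub_nonneg.2 h1) _)
    (Real.exp_nonneg _)
  refine hA.trans ?_
  rw [← Real.exp_add, ← Real.le_log_iff_exp_le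
      (div_pos (mul_pos (hG k) (hG j)) (mul_pos hpi (hG (k + j)))),
    Real.log_div (mul_pos (hG k) (hG j)).ne' (mul_pos hpi (hG _)).ne',
    Real.log_mul (hG k).ne' (hG j).ne', Real.log_mul hpi.ne' (hG _).ne']
  have h := log_Gamma_add_half_add_le k j
  have e : ((k + j : ℕ) : ℝ) = k + j := by push_cast; ring
  rw [e] at h ⊢
  linarith

/-! ### Beta mixtures and the universal portfolio -/

theorem lintegral_pow_mul_one_sub_pow_betaMeasure {α β : ℝ} (hα : 0 < α) (hβ : 0 < β) (k j : ℕ) :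
    ∫⁻ t, ENNReal.ofReal t ^ k * ENNReal.ofReal (1 - t) ^ j ∂betaMeasure α β =
      ENNReal.ofReal (beta (k + α) (j + β) / beta α β) := by
  have hk : 0 < k + α := by positivity
  have hj : 0 < j + β := by positivity
  have hb := beta_pos hα hβ
  have hb' := beta_pos hk hj
  have hm : Measurable (betaPDF α β) := (measurable_betaPDFReal α β).ennreal_ofReal
  have hm' : Measurable (betaPDF (k + α) (j + β)) := (measurable_betaPDFReal _ _).ennreal_ofReal
  rw [betaMeasure, lintegral_withDensity_eq_lintegral_mul _ hm (by fun_prop)]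
  -- Writing the right side as a multiple of the mass of Beta(k+α, j+β) reduces the claim to an
  -- identity of densities.
  rw [← mul_one (ENNReal.ofReal _), ← lintegral_betaPDF_eq_one hk hj, ← lintegral_const_mul _ hm']
  refine lintegral_congr fun t => ?_
  rw [Pi.mul_apply]
  by_cases ht : 0 < t ∧ t < 1
  · obtain ⟨h0, h1⟩ := ht
    have h1' : 0 < 1 - t := sub_pos.2 h1
    rw [betaPDF_of_pos_lt_one h0 h1, betaPDF_of_pos_lt_one h0 h1,
      ← ENNReal.ofReal_pow h0.le, ← ENNReal.ofReal_pow h1'.le,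
      ← ENNReal.ofReal_mul (by positivity), ← ENNReal.ofReal_mul (by positivity),
      ← ENNReal.ofReal_mul (by positivity)]
    congr 1
    rw [add_sub_assoc, add_sub_assoc, Real.rpow_add h0, Real.rpow_add h1', Real.rpow_natCast,
      Real.rpow_natCast]
    field_simp
  · simp [betaPDF_eq, ht]

theorem beta_half_half : beta (1 / 2) (1 / 2) = Real.pi := by
  rw [beta, Real.Gamma_one_half_eq, Real.mul_self_sqrt Real.pi_pos.le]
  norm_num

/-- The worst-case ratio between the best constant rebalanced portfolio of two assets over `n`
periods and the `Beta (1/2, 1/2)` mixture of these portfolios. -/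
def mixtureRegret (n : ℕ) : ℝ :=
  Real.sqrt Real.pi * Real.Gamma ((n : ℝ) + 1) / Real.Gamma ((n : ℝ) + 1 / 2)

theorem mixtureRegret_pos (n : ℕ) : 0 < mixtureRegret n := by
  have h1 : 0 < Real.Gamma ((n : ℝ) + 1) := Real.Gamma_pos_of_pos (by positivity)
  have h2 : 0 < Real.Gamma ((n : ℝ) + 1 / 2) := Real.Gamma_pos_of_pos (by positivity)
  have := Real.pi_pos
  unfold mixtureRegret; positivity

theorem pow_mul_one_sub_pow_le_lintegral {b : ℝ} (h0 : 0 ≤ b) (h1 : b ≤ 1) (k j : ℕ) :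
    ENNReal.ofReal b ^ k * ENNReal.ofReal (1 - b) ^ j ≤ ENNReal.ofReal (mixtureRegret (k + j)) *
      ∫⁻ t, ENNReal.ofReal t ^ k * ENNReal.ofReal (1 - t) ^ j ∂betaMeasure (1 / 2) (1 / 2) := by
  have h1' : 0 ≤ 1 - b := sub_nonneg.2 h1
  rw [lintegral_pow_mul_one_sub_pow_betaMeasure (by norm_num) (by norm_num), beta_half_half,
    ← ENNReal.ofReal_pow h0, ← ENNReal.ofReal_pow h1', ← ENNReal.ofReal_mul (by positivity),
    ← ENNReal.ofReal_mul (mixtureRegret_pos _).le]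
  refine ENNReal.ofReal_le_ofReal ((pow_mul_one_sub_pow_le_Gamma h0 h1 k j).trans_eq ?_)
  have hg : Real.Gamma (((k + j : ℕ) : ℝ) + 1) ≠ 0 := (Real.Gamma_pos_of_pos (by positivity)).ne'
  have hg2 : Real.Gamma (((k + j : ℕ) : ℝ) + 1 / 2) ≠ 0 :=
    (Real.Gamma_pos_of_pos (by positivity)).ne'
  have hpi : 0 < Real.sqrt Real.pi := Real.sqrt_pos.2 Real.pi_pos
  have e : (k : ℝ) + 1 / 2 + (j + 1 / 2) = ((k + j : ℕ) : ℝ) + 1 := by push_cast; ring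
  rw [mixtureRegret, beta, e]
  conv_rhs => rw [← Real.mul_self_sqrt Real.pi_pos.le]
  rw [Real.sqrt_mul_self hpi.le]
  field_simp

/-- Cover and Ordentlich's regret bound for the universal portfolio of two assets. -/
theorem prod_portfolio_le_lintegral {b : ℝ} (h0 : 0 ≤ b) (h1 : b ≤ 1) {n : ℕ}
    (p q : Fin n → ℝ≥0∞) :
    ∏ i, (ENNReal.ofReal b * p i + ENNReal.ofReal (1 - b) * q i) ≤
      ENNReal.ofReal (mixtureRegret n) *
        ∫⁻ t, ∏ i, (ENNReal.ofReal t * p i + ENNReal.ofReal (1 - t) * q i)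
          ∂betaMeasure (1 / 2) (1 / 2) := by
  -- Expanding over subsets gives a nonnegative combination of monomials `t^k (1-t)^j` with `k + j =
  -- n`, all sharing one regret constant.
  have key : ∀ t : ℝ, ∏ i, (ENNReal.ofReal t * p i + ENNReal.ofReal (1 - t) * q i) =
      ∑ s : Finset (Fin n), (ENNReal.ofReal t ^ s.card * ENNReal.ofReal (1 - t) ^ sᶜ.card) *
        ((∏ i ∈ s, p i) * ∏ i ∈ sᶜ, q i) := by
    intro t
    rw [Fintype.prod_add]
    refine Finset.sum_congr rfl fun s _ => ?_
    rw [Finset.prod_mul_distrib, Finset.prod_mul_distrib, Finset.prod_const, Finset.prod_const]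
    ring
  simp_rw [key]
  rw [lintegral_finsetSum _ (fun s _ => by fun_prop), Finset.mul_sum]
  refine Finset.sum_le_sum fun s _ => ?_
  rw [lintegral_mul_const _ (by fun_prop), ← mul_assoc (ENNReal.ofReal (mixtureRegret n))]
  have h := pow_mul_one_sub_pow_le_lintegral h0 h1 s.card sᶜ.card
  have e : s.card + sᶜ.card = n := by simp [Finset.card_add_card_compl]
  rw [e] at h
  exact mul_le_mul_left h _

/-! ### Bets as two-asset portfolios -/

/-- The wealth factor of the portfolio that invests the fraction `b` in the asset with return `y / m`
and the rest in the asset with return `(1 - y) / (1 - m)`. -/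
def portfolioFactor (m y b : ℝ) : ℝ≥0∞ :=
  ENNReal.ofReal b * (ENNReal.ofReal y / ENNReal.ofReal m) +
    ENNReal.ofReal (1 - b) * (ENNReal.ofReal (1 - y) / ENNReal.ofReal (1 - m))

theorem portfolioFactor_one_sub (m y b : ℝ) :
    portfolioFactor (1 - m) (1 - y) (1 - b) = portfolioFactor m y b := by
  simp [portfolioFactor, add_comm]

theorem prod_portfolioFactor_le {b m : ℝ} (h0 : 0 ≤ b) (h1 : b ≤ 1) {n : ℕ} (y : Fin n → ℝ) :
    ∏ i, portfolioFactor m (y i) b ≤ ENNReal.ofReal (mixtureRegret n) *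
      ∫⁻ t, ∏ i, portfolioFactor m (y i) t ∂betaMeasure (1 / 2) (1 / 2) :=
  prod_portfolio_le_lintegral h0 h1 _ _

/-- The weight solves `b/m - (1-b)/(1-m) = l`; `betRange` says exactly that both portfolio weights
are nonnegative. -/
theorem portfolioFactor_eq_ofReal {m y l : ℝ} (hm0 : 0 < m) (hm1 : m < 1) (hl : l ∈ betRange m)
    (hy : y ∈ Set.Icc (0 : ℝ) 1) :
    portfolioFactor m y (m * (1 + l * (1 - m))) = ENNReal.ofReal (1 + l * (y - m)) := by
  have hm1' : 0 < 1 - m := sub_pos.2 hm1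
  obtain ⟨hl1, hl2⟩ := hl
  obtain ⟨hy0, hy1⟩ := hy
  have hy1' : 0 ≤ 1 - y := sub_nonneg.2 hy1
  have hA : 0 ≤ m * (1 + l * (1 - m)) := mul_nonneg hm0.le (by linarith)
  have e : 1 - m * (1 + l * (1 - m)) = (1 - m) * (1 - l * m) := by ring
  have hB : 0 ≤ (1 - m) * (1 - l * m) := mul_nonneg hm1'.le (by linarith)
  rw [portfolioFactor, e, ← ENNReal.ofReal_div_of_pos hm0, ← ENNReal.ofReal_div_of_pos hm1',
    ← ENNReal.ofReal_mul hA, ← ENNReal.ofReal_mul hB, ← ENNReal.ofReal_add (by positivity)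
    (by positivity)]
  congr 1
  field_simp
  ring

/-- If all `y i` vanish, the second asset keeps wealth 1. Otherwise a positive `y i` over 0 is `∞`,
and `b = 1/2` keeps the other factors nonzero, so the product is `∞`. -/
theorem exists_prod_le_prod_portfolioFactor_zero {n : ℕ} {y : Fin n → ℝ}
    (hy : ∀ i, y i ∈ Set.Icc (0 : ℝ) 1) (l : ℝ) :
    ∃ b ∈ Set.Icc (0 : ℝ) 1, ∏ i, ENNReal.ofReal (1 + l * (y i - 0)) ≤
      ∏ i, portfolioFactor 0 (y i) b := by
  by_cases h : ∀ i, y i = 0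
  · exact ⟨0, by simp, by simp [portfolioFactor, h]⟩
  push Not at h
  obtain ⟨i₀, hi₀⟩ := h
  refine ⟨1 / 2, by norm_num, ?_⟩
  have hpos : ∀ i, y i ≠ 0 → portfolioFactor 0 (y i) (1 / 2) = ∞ := by
    intro i hi
    have h2 : 0 < y i := lt_of_le_of_ne (hy i).1 hi.symm
    simp [portfolioFactor, ENNReal.div_zero, h2, ENNReal.mul_top]
  have hne : ∀ i, portfolioFactor 0 (y i) (1 / 2) ≠ 0 := by
    intro i
    by_cases hi : y i = 0
    · simp [portfolioFactor, hi]; norm_num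
    · rw [hpos i hi]; exact ENNReal.top_ne_zero
  have : ∏ i, portfolioFactor 0 (y i) (1 / 2) = ∞ := by
    rw [← Finset.mul_prod_erase _ _ (Finset.mem_univ i₀), hpos i₀ hi₀,
      ENNReal.top_mul (Finset.prod_ne_zero_iff.2 fun i _ => hne i)]
  rw [this]
  exact le_top

theorem exists_prod_le_prod_portfolioFactor {n : ℕ} {y : Fin n → ℝ}
    (hy : ∀ i, y i ∈ Set.Icc (0 : ℝ) 1) {m l : ℝ} (hm : m ∈ Set.Icc (0 : ℝ) 1)
    (hl : l ∈ betRange m) :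
    ∃ b ∈ Set.Icc (0 : ℝ) 1, ∏ i, ENNReal.ofReal (1 + l * (y i - m)) ≤
      ∏ i, portfolioFactor m (y i) b := by
  rcases hm.1.eq_or_lt with rfl | hm0
  · exact exists_prod_le_prod_portfolioFactor_zero hy l
  rcases hm.2.eq_or_lt with rfl | hm1
  -- Swapping the two assets turns `m = 1` into `m = 0`.
  · obtain ⟨b, hb, h⟩ := exists_prod_le_prod_portfolioFactor_zero (y := fun i => 1 - y i)
      (fun i => ⟨sub_nonneg.2 (hy i).2, sub_le_self _ (hy i).1⟩) (-l)
    refine ⟨1 - b, ⟨sub_nonneg.2 hb.2, sub_le_self _ hb.1⟩, ?_⟩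
    have e : ∀ i, portfolioFactor 0 (1 - y i) b = portfolioFactor 1 (y i) (1 - b) := fun i => by
      rw [← portfolioFactor_one_sub 1 (y i) (1 - b)]; simp
    simp_rw [← e]
    refine le_of_eq_of_le (Finset.prod_congr rfl fun i _ => ?_) h
    congr 1; ring
  · refine ⟨m * (1 + l * (1 - m)), ⟨mul_nonneg hm0.le (by linarith [hl.1]), ?_⟩,
      (Finset.prod_congr rfl fun i _ => (portfolioFactor_eq_ofReal hm0 hm1 hl (hy i)).symm).le⟩
    have h2 : l * m ≤ 1 := hl.2
    have h3 : 0 ≤ (1 - m) * (1 - l * m) := mul_nonneg (sub_nonneg.2 hm.2) (by linarith)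
    nlinarith

theorem optLogWealth_le_log_lintegral {n : ℕ} {y : Fin n → ℝ}
    (hy : ∀ i, y i ∈ Set.Icc (0 : ℝ) 1) {m : ℝ} (hm : m ∈ Set.Icc (0 : ℝ) 1) :
    optLogWealth y m ≤ ENNReal.log (ENNReal.ofReal (mixtureRegret n) *
      ∫⁻ t, ∏ i, portfolioFactor m (y i) t ∂betaMeasure (1 / 2) (1 / 2)) := by
  refine iSup₂_le fun l hl => ?_
  rw [logWealth_eq_log_prod]
  obtain ⟨b, hb, h⟩ := exists_prod_le_prod_portfolioFactor hy hm hl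
  exact ENNReal.log_le_log (h.trans (prod_portfolioFactor_le hb.1 hb.2 y))

/-! ### Mixture wealth as a supermartingale; Ville's inequality -/

/-- The wealth at time `n` of the mixture over `ρ` of the strategies with wealth factors `g z`. -/
def mixtureWealth {Ω 𝒳 Z : Type*} [MeasurableSpace Z] (ρ : Measure Z)
    (g : Z → 𝒳 → ℝ≥0∞) (X : ℕ → Ω → 𝒳) (n : ℕ) (ω : Ω) : ℝ≥0∞ :=
  ∫⁻ z, ∏ i ∈ Finset.range n, g z (X i ω) ∂ρ

/-- The information in the observations before time `n`. -/
@[reducible]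
def strictPast {Ω 𝒳 : Type*} [m𝒳 : MeasurableSpace 𝒳] (X : ℕ → Ω → 𝒳) (n : ℕ) :
    MeasurableSpace Ω :=
  ⨆ i ∈ Set.Iio n, m𝒳.comap (X i)

theorem strictPast_le {Ω 𝒳 : Type*} [mΩ : MeasurableSpace Ω] [MeasurableSpace 𝒳]
    {X : ℕ → Ω → 𝒳} (hX : ∀ i, Measurable (X i)) (n : ℕ) :
    strictPast X n ≤ mΩ :=
  iSup₂_le fun i _ => (hX i).comap_le

theorem measurable_strictPast {Ω 𝒳 : Type*} [m𝒳 : MeasurableSpace 𝒳] {X : ℕ → Ω → 𝒳}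
    {i n : ℕ} (h : i < n) :
    Measurable[strictPast X n] (X i) :=
  Measurable.mono (comap_measurable (X i))
    (le_iSup₂ (f := fun i (_ : i ∈ Set.Iio n) => m𝒳.comap (X i)) i h) le_rfl

theorem strictPast_mono {Ω 𝒳 : Type*} [m𝒳 : MeasurableSpace 𝒳] (X : ℕ → Ω → 𝒳) :
    Monotone (strictPast X) := fun _ _ h =>
  iSup₂_le fun i hi => le_iSup₂ (f := fun i (_ : i ∈ Set.Iio _) => m𝒳.comap (X i)) i
    (lt_of_lt_of_le hi h)

theorem measurable_mixtureWealth {Ω 𝒳 Z : Type*} [MeasurableSpace 𝒳] [MeasurableSpace Z]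
    (ρ : Measure Z) [SFinite ρ] {g : Z → 𝒳 → ℝ≥0∞}
    (hg : Measurable (Function.uncurry g)) (X : ℕ → Ω → 𝒳) (n : ℕ) :
    Measurable[strictPast X n] (mixtureWealth ρ g X n) := by
  let _ : MeasurableSpace Ω := strictPast X n
  refine Measurable.lintegral_prod_right' (f := fun p : Ω × Z =>
    ∏ i ∈ Finset.range n, g p.2 (X i p.1)) ?_
  refine Finset.measurable_prod _ fun i hi => ?_
  have hXi : Measurable (X i) := measurable_strictPast (Finset.mem_range.1 hi)
  exact hg.comp (measurable_snd.prodMk (hXi.comp measurable_fst))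

/-- The supermartingale property, tested on past events. By Tonelli it suffices to fix `z`; there
the new factor is independent of the past and has mean at most 1. -/
theorem setLIntegral_mixtureWealth_succ_le {Ω 𝒳 Z : Type*} [MeasurableSpace Ω]
    [m𝒳 : MeasurableSpace 𝒳] [MeasurableSpace Z] {μ : Measure Ω} [IsProbabilityMeasure μ]
    {X : ℕ → Ω → 𝒳} (hX : ∀ i, Measurable (X i)) (hindep : iIndepFun X μ)
    (ρ : Measure Z) [SFinite ρ] {g : Z → 𝒳 → ℝ≥0∞} (hg : Measurable (Function.uncurry g))
    (hg1 : ∀ z i, ∫⁻ ω, g z (X i ω) ∂μ ≤ 1) {n : ℕ} {A : Set Ω}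
    (hA : MeasurableSet[strictPast X n] A) :
    ∫⁻ ω in A, mixtureWealth ρ g X (n + 1) ω ∂μ ≤ ∫⁻ ω in A, mixtureWealth ρ g X n ω ∂μ := by
  have hA' : MeasurableSet A := strictPast_le hX n _ hA
  have hgz : ∀ z, Measurable (g z) := fun z => hg.comp measurable_prodMk_left
  have hprod : ∀ k, Measurable fun p : Ω × Z => ∏ i ∈ Finset.range k, g p.2 (X i p.1) := fun k =>
    Finset.measurable_prod _ fun i _ =>
      hg.comp (measurable_snd.prodMk ((hX i).comp measurable_fst))
  unfold mixtureWealth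
  have hswap : ∀ k, ∫⁻ ω in A, ∫⁻ z, ∏ i ∈ Finset.range k, g z (X i ω) ∂ρ ∂μ =
      ∫⁻ z, ∫⁻ ω in A, ∏ i ∈ Finset.range k, g z (X i ω) ∂μ ∂ρ := fun k =>
    lintegral_lintegral_swap (hprod k).aemeasurable
  rw [hswap, hswap]
  refine lintegral_mono fun z => ?_
  rw [← lintegral_indicator hA', ← lintegral_indicator hA']
  have hind : Indep (strictPast X n) (m𝒳.comap (X n)) μ := by
    have := indep_iSup_of_disjoint (m := fun i => m𝒳.comap (X i)) (fun i => (hX i).comap_le)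
      ((iIndepFun_iff_iIndep _ _ _).1 hindep) (S := Set.Iio n) (T := {n}) (by simp)
    simpa [strictPast] using this
  have hpast : Measurable[strictPast X n]
      (A.indicator fun ω => ∏ i ∈ Finset.range n, g z (X i ω)) := by
    refine Measurable.indicator ?_ hA
    exact Finset.measurable_prod _ fun i hi =>
      (hgz z).comp (measurable_strictPast (Finset.mem_range.1 hi))
  have e : ∀ ω, A.indicator (fun ω => ∏ i ∈ Finset.range (n + 1), g z (X i ω)) ω =
      A.indicator (fun ω => ∏ i ∈ Finset.range n, g z (X i ω)) ω * g z (X n ω) := fun ω => by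
    by_cases h : ω ∈ A <;> simp [h, Finset.prod_range_succ]
  simp_rw [e]
  refine (lintegral_mul_eq_lintegral_mul_lintegral_of_independent_measurableSpace
    (strictPast_le hX n) (hX n).comap_le hind hpast
    ((hgz z).comp (comap_measurable (X n)))).trans_le ?_
  exact mul_le_of_le_one_right' (hg1 z n)

/-- Ville's inequality for mixture wealth. -/
theorem mul_measure_exists_le_mixtureWealth_le_one {Ω 𝒳 Z : Type*} [MeasurableSpace Ω]
    [MeasurableSpace 𝒳] [MeasurableSpace Z] {μ : Measure Ω} [IsProbabilityMeasure μ]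
    {X : ℕ → Ω → 𝒳} (hX : ∀ i, Measurable (X i)) (hindep : iIndepFun X μ)
    (ρ : Measure Z) [IsProbabilityMeasure ρ] {g : Z → 𝒳 → ℝ≥0∞}
    (hg : Measurable (Function.uncurry g))
    (hg1 : ∀ z i, ∫⁻ ω, g z (X i ω) ∂μ ≤ 1) (c : ℝ≥0∞) :
    c * μ {ω | ∃ n, c ≤ mixtureWealth ρ g X n ω} ≤ 1 := by
  set M := mixtureWealth ρ g X
  have hM : ∀ n, Measurable[strictPast X n] (M n) := measurable_mixtureWealth ρ hg X
  have hM' : ∀ n, Measurable (M n) := fun n => (hM n).mono (strictPast_le hX n) le_rfl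
  let B : ℕ → Set Ω := fun n => ⋂ k ∈ Set.Iic n, {ω | M k ω < c}
  have hBmem : ∀ n ω, ω ∈ B n ↔ ∀ k ≤ n, M k ω < c := fun n ω => by simp [B]
  have hB : ∀ n, MeasurableSet[strictPast X n] (B n) := fun n =>
    MeasurableSet.biInter (Set.to_countable _) fun k hk =>
      strictPast_mono X hk _ ((hM k) measurableSet_Iio)
  have hB' : ∀ n, MeasurableSet (B n) := fun n => strictPast_le hX n _ (hB n)
  have hM0 : ∀ ω, M 0 ω = 1 := fun ω => by simp [M, mixtureWealth]
  have markov : ∀ n (A : Set Ω), MeasurableSet A →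
      c * μ (A \ {ω | M n ω < c}) + ∫⁻ ω in A ∩ {ω | M n ω < c}, M n ω ∂μ ≤
        ∫⁻ ω in A, M n ω ∂μ := by
    intro n A hA
    have hS : MeasurableSet {ω | M n ω < c} := hM' n measurableSet_Iio
    rw [← lintegral_inter_add_sdiff (M n) A hS, add_comm]
    gcongr
    rw [← setLIntegral_const]
    refine setLIntegral_mono' (hA.diff hS) fun ω hω => ?_
    exact not_lt.1 hω.2
  -- The left side is the mean of the wealth stopped on reaching `c`, with the stopped value
  -- replaced by `c`.
  have key : ∀ n, c * μ (B n)ᶜ + ∫⁻ ω in B n, M n ω ∂μ ≤ 1 := by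
    intro n
    induction n with
    | zero =>
      have e : B 0 = Set.univ ∩ {ω | M 0 ω < c} := by ext ω; simp [hBmem]
      have h := markov 0 Set.univ MeasurableSet.univ
      rw [← e] at h
      have e2 : (Set.univ : Set Ω) \ {ω | M 0 ω < c} = (B 0)ᶜ := by
        rw [e, Set.univ_inter, Set.compl_eq_univ_sdiff]
      rw [e2] at h
      refine h.trans ?_
      simp [hM0]
    | succ n ih =>
      have e : B (n + 1) = B n ∩ {ω | M (n + 1) ω < c} := by
        ext ω
        simp only [hBmem, Set.mem_inter_iff, Set.mem_ofPred_eq]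
        simp only [Nat.le_succ_iff, or_imp, forall_and, forall_eq]
      have e2 : (B (n + 1))ᶜ = (B n)ᶜ ∪ (B n \ {ω | M (n + 1) ω < c}) := by
        rw [e]; ext ω; simp; tauto
      calc c * μ (B (n + 1))ᶜ + ∫⁻ ω in B (n + 1), M (n + 1) ω ∂μ
          ≤ c * μ (B n)ᶜ + (c * μ (B n \ {ω | M (n + 1) ω < c}) +
              ∫⁻ ω in B n ∩ {ω | M (n + 1) ω < c}, M (n + 1) ω ∂μ) := by
            rw [e2, ← e, ← add_assoc, ← mul_add]
            gcongr
            exact measure_union_le _ _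
        _ ≤ c * μ (B n)ᶜ + ∫⁻ ω in B n, M (n + 1) ω ∂μ := by
            gcongr
            exact markov (n + 1) (B n) (hB' n)
        _ ≤ c * μ (B n)ᶜ + ∫⁻ ω in B n, M n ω ∂μ := by
            exact add_le_add_right
              (setLIntegral_mixtureWealth_succ_le hX hindep ρ hg hg1 (hB n)) _
        _ ≤ 1 := ih
  have eU : {ω | ∃ n, c ≤ M n ω} = ⋃ n, (B n)ᶜ := by
    ext ω
    simp only [Set.mem_ofPred_eq, Set.mem_iUnion, Set.mem_compl_iff, hBmem, not_forall, not_lt]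
    exact ⟨fun ⟨n, h⟩ => ⟨n, n, le_rfl, h⟩, fun ⟨_, k, _, h⟩ => ⟨k, h⟩⟩
  have hmono : Monotone fun n => (B n)ᶜ := fun a b hab ω hω h =>
    hω ((hBmem a ω).2 fun k hk => (hBmem b ω).1 h k (hk.trans hab))
  rw [eU, hmono.measure_iUnion, ENNReal.mul_iSup]
  exact iSup_le fun n => le_self_add.trans (key n)

/-! ### Change of measure -/

/-- Pointwise Donsker-Varadhan, from `log x ≤ x - 1` at `x = h/(H r)`. The 1 stays on the left so
that nothing is subtracted in `ℝ≥0∞`; it cancels the integral of `h/H`. -/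
theorem mul_log_add_one_le_klFun {r h H : ℝ} (hr : 0 ≤ r) (hh : 0 < h) (hH : 0 < H) :
    r * Real.log h + 1 ≤ klFun r + h / H + r * Real.log H := by
  rw [klFun_apply]
  rcases hr.eq_or_lt with rfl | hr
  · have : 0 < h / H := by positivity
    simp; exact this.le
  have h1 := Real.log_le_sub_one_of_pos (x := h / H / r) (by positivity)
  rw [Real.log_div (by positivity) hr.ne', Real.log_div hh.ne' hH.ne'] at h1
  have h2 := mul_le_mul_of_nonneg_left h1 hr.le
  have e : r * (h / H / r - 1) = h / H - r := by field_simp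
  rw [e] at h2
  linarith

/-- The Donsker-Varadhan inequality for the exponential moment of a nonnegative function, written
as `log h` with `1 ≤ h`. -/
theorem lintegral_log_le_klDiv_add {α : Type*} [MeasurableSpace α] {P Q : Measure α}
    [IsProbabilityMeasure P] [IsProbabilityMeasure Q] {h : α → ℝ≥0∞} (hm : Measurable h)
    (h1 : ∀ x, 1 ≤ h x) (hfin : ∫⁻ x, h x ∂Q ≠ ∞) :
    ∫⁻ x, (ENNReal.log (h x)).toENNReal ∂P ≤
      klDiv P Q + (ENNReal.log (∫⁻ x, h x ∂Q)).toENNReal := by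
  by_cases hac : P ≪ Q
  swap
  · simp [klDiv_of_not_ac hac]
  have hlog : ∀ {x : ℝ≥0∞}, 1 ≤ x → x ≠ ∞ →
      (ENNReal.log x).toENNReal = ENNReal.ofReal (Real.log x.toReal) := fun {x} hx hx' => by
    rw [ENNReal.log_pos_real (one_pos.trans_le hx).ne' hx', EReal.toENNReal_of_ne_top (by simp),
      EReal.toReal_coe]
  set H := ∫⁻ x, h x ∂Q with hHdef
  have hH1 : 1 ≤ H := by
    calc (1 : ℝ≥0∞) = ∫⁻ _, 1 ∂Q := by simp
      _ ≤ H := lintegral_mono h1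
  have hH0 : 0 < H.toReal := ENNReal.toReal_pos (one_pos.trans_le hH1).ne' hfin
  have hH1' : 1 ≤ H.toReal := by simpa using ENNReal.toReal_mono hfin hH1
  have hlm : Measurable fun x => (ENNReal.log (h x)).toENNReal := hm.ennreal_log.ereal_toENNReal
  rw [klDiv_eq_lintegral_klFun_of_ac hac, ← lintegral_rnDeriv_mul hac hlm.aemeasurable]
  have hr : ∫⁻ x, P.rnDeriv Q x ∂Q = 1 := by
    rw [Measure.lintegral_rnDeriv hac]; simp
  have hpt : ∀ᵐ x ∂Q, P.rnDeriv Q x * (ENNReal.log (h x)).toENNReal + 1 ≤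
      ENNReal.ofReal (klFun (P.rnDeriv Q x).toReal) + h x / H +
        P.rnDeriv Q x * (ENNReal.log H).toENNReal := by
    filter_upwards [ae_lt_top hm hfin, Measure.rnDeriv_lt_top P Q] with x hx hrx
    have hx1' : 1 ≤ (h x).toReal := by simpa using ENNReal.toReal_mono hx.ne (h1 x)
    rw [hlog (h1 x) hx.ne, hlog hH1 hfin]
    set r := (P.rnDeriv Q x).toReal with hrdef
    have e1 : P.rnDeriv Q x = ENNReal.ofReal r := (ENNReal.ofReal_toReal hrx.ne).symm
    have e2 : h x / H = ENNReal.ofReal ((h x).toReal / H.toReal) := by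
      rw [ENNReal.ofReal_div_of_pos hH0, ENNReal.ofReal_toReal hx.ne, ENNReal.ofReal_toReal hfin]
    have hr0 : 0 ≤ r := ENNReal.toReal_nonneg
    have l1 := Real.log_nonneg hx1'
    have l2 := Real.log_nonneg hH1'
    have l3 := klFun_nonneg hr0
    rw [e1, e2, ← ENNReal.ofReal_mul hr0, ← ENNReal.ofReal_mul hr0, ← ENNReal.ofReal_one,
      ← ENNReal.ofReal_add (by positivity) zero_le_one,
      ← ENNReal.ofReal_add l3 (by positivity), ← ENNReal.ofReal_add (by positivity) (by positivity)]
    exact ENNReal.ofReal_le_ofReal (mul_log_add_one_le_klFun hr0 (by linarith) hH0)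
  have hint := lintegral_mono_ae hpt
  have hrm := Measure.measurable_rnDeriv P Q
  rw [lintegral_add_right _ measurable_const, lintegral_add_right _ (hrm.mul_const _),
    lintegral_add_right _ (hm.div_const _), lintegral_mul_const _ hrm, hr] at hint
  simp_rw [div_eq_mul_inv] at hint
  rw [lintegral_mul_const _ hm, ← hHdef,
    ENNReal.mul_inv_cancel (one_pos.trans_le hH1).ne' hfin] at hint
  simp only [lintegral_const, measure_univ, mul_one, one_mul] at hint
  rw [add_right_comm] at hint
  exact (ENNReal.add_le_add_iff_right ENNReal.one_ne_top).1 hint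

/-! ### Fairness of the portfolios and the final bound -/

theorem measurable_portfolioFactor {α : Type*} [MeasurableSpace α] {m y b : α → ℝ}
    (hm : Measurable m) (hy : Measurable y) (hb : Measurable b) :
    Measurable fun a => portfolioFactor (m a) (y a) (b a) := by
  unfold portfolioFactor
  fun_prop

/-- Each asset has mean return `m/m` or `(1-m)/(1-m)`, which is 1, or 0 when the denominator
vanishes; hence only an inequality. -/
theorem lintegral_portfolioFactor_le_one {Ω : Type*} [MeasurableSpace Ω] {μ : Measure Ω}
    [IsProbabilityMeasure μ] {Y : Ω → ℝ} (hY : Measurable Y) (hY01 : ∀ ω, Y ω ∈ Set.Icc (0 : ℝ) 1)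
    {b : ℝ} (hb : b ∈ Set.Icc (0 : ℝ) 1) :
    ∫⁻ ω, portfolioFactor (∫ ω, Y ω ∂μ) (Y ω) b ∂μ ≤ 1 := by
  have hint : Integrable Y μ := Integrable.of_mem_Icc 0 1 hY.aemeasurable (ae_of_all _ hY01)
  have h1 : ∫⁻ ω, ENNReal.ofReal (Y ω) ∂μ = ENNReal.ofReal (∫ ω, Y ω ∂μ) :=
    (ofReal_integral_eq_lintegral_ofReal hint (ae_of_all _ fun ω => (hY01 ω).1)).symm
  have h2 : ∫⁻ ω, ENNReal.ofReal (1 - Y ω) ∂μ = ENNReal.ofReal (1 - ∫ ω, Y ω ∂μ) := by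
    have h := ofReal_integral_eq_lintegral_ofReal (f := fun ω => 1 - Y ω)
      ((integrable_const 1).sub hint) (ae_of_all _ fun ω => sub_nonneg.2 (hY01 ω).2)
    rw [← h, integral_sub (integrable_const 1) hint]
    simp
  unfold portfolioFactor
  simp_rw [div_eq_mul_inv]
  rw [lintegral_add_left (by fun_prop), lintegral_const_mul _ (by fun_prop),
    lintegral_const_mul _ (by fun_prop), lintegral_mul_const _ (by fun_prop),
    lintegral_mul_const _ (by fun_prop), h1, h2, ← div_eq_mul_inv, ← div_eq_mul_inv]
  calc _ ≤ ENNReal.ofReal b * 1 + ENNReal.ofReal (1 - b) * 1 := by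
        gcongr <;> exact ENNReal.div_self_le_one
    _ = 1 := by
        rw [mul_one, mul_one, ← ENNReal.ofReal_add hb.1 (sub_nonneg.2 hb.2)]
        simp

theorem exp_le_of_le_sub_sub_log {a c : ℝ} {I K M : ℝ≥0∞} (hc : 0 < c)
    (h : (a : EReal) ≤ (I : EReal) - (K : EReal) - ((Real.log c : ℝ) : EReal))
    (hM1 : 1 ≤ ENNReal.ofReal c * M)
    (hI : ENNReal.ofReal c * M ≠ ∞ →
      I ≤ K + (ENNReal.log (ENNReal.ofReal c * M)).toENNReal) :
    ENNReal.ofReal (Real.exp a) ≤ M := by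
  have hc' : ENNReal.ofReal c ≠ 0 := (ENNReal.ofReal_pos.2 hc).ne'
  by_cases hM : M = ∞
  · simp [hM]
  have hfin : ENNReal.ofReal c * M ≠ ∞ := ENNReal.mul_ne_top ENNReal.ofReal_ne_top hM
  specialize hI hfin
  have hM0 : M ≠ 0 := by rintro rfl; simp at hM1
  have hMr : 0 < M.toReal := ENNReal.toReal_pos hM0 hM
  -- In `EReal`, `⊤ - ⊤ = ⊥`, so infinite divergence contradicts `h` even when `I = ∞`.
  by_cases hK : K = ∞
  · subst hK
    simp [sub_eq_add_neg] at h
  have e : ENNReal.ofReal c * M = ENNReal.ofReal (c * M.toReal) := by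
    rw [ENNReal.ofReal_mul hc.le, ENNReal.ofReal_toReal hM]
  rw [e, ENNReal.log_ofReal_of_pos (by positivity), EReal.toENNReal_of_ne_top (by simp),
    EReal.toReal_coe] at hI
  have hl : 0 ≤ Real.log (c * M.toReal) := by
    refine Real.log_nonneg ?_
    rwa [e, ENNReal.one_le_ofReal] at hM1
  have hIt : I ≠ ∞ := ne_top_of_le_ne_top (ENNReal.add_ne_top.2 ⟨hK, ENNReal.ofReal_ne_top⟩) hI
  lift I to NNReal using hIt
  lift K to NNReal using hK
  have hI' : (I : ℝ) ≤ K + Real.log (c * M.toReal) := by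
    have := ENNReal.toReal_mono (by simp) hI
    rwa [ENNReal.toReal_add (by simp) (by simp), ENNReal.toReal_ofReal hl] at this
  have h' : a ≤ (I : ℝ) - K - Real.log c := by
    rw [EReal.coe_nnreal_eq_coe_real, EReal.coe_nnreal_eq_coe_real] at h
    exact_mod_cast h
  rw [Real.log_mul hc.ne' hMr.ne'] at hI'
  rw [ENNReal.ofReal_le_iff_le_toReal hM, ← Real.le_log_iff_exp_le hMr]
  linarith

theorem ae_betaMeasure_mem_Icc (α β : ℝ) : ∀ᵐ t ∂betaMeasure α β, t ∈ Set.Icc (0 : ℝ) 1 := by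
  have hm : Measurable (betaPDF α β) := (measurable_betaPDFReal α β).ennreal_ofReal
  rw [betaMeasure, ae_withDensity_iff hm]
  refine ae_of_all _ fun t ht => ?_
  by_contra hmem
  refine ht ?_
  rw [Set.mem_Icc, not_and_or, not_le, not_le] at hmem
  rcases hmem with h | h
  · exact betaPDF_eq_zero_of_nonpos h.le
  · exact betaPDF_eq_zero_of_one_le h.le

end

theorem theorem1 {Ω 𝒳 Θ : Type*} [MeasurableSpace Ω] [MeasurableSpace 𝒳] [MeasurableSpace Θ]
    (μ : Measure Ω) [IsProbabilityMeasure μ]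
    (X : ℕ → Ω → 𝒳) (hX : ∀ i, Measurable (X i))
    (hindep : iIndepFun X μ) (hident : ∀ i, IdentDistrib (X i) (X 0) μ μ)
    (f : Θ → 𝒳 → ℝ) (hf : Measurable (Function.uncurry f))
    (hf01 : ∀ θ x, f θ x ∈ Set.Icc (0 : ℝ) 1)
    (P₀ : Measure Θ) [IsProbabilityMeasure P₀]
    (δ : ℝ) (hδ0 : 0 < δ) (hδ1 : δ ≤ 1) :
    μ {ω | ∃ n : ℕ, ∃ P : Kernel (Fin n → 𝒳) Θ, IsMarkovKernel P ∧
      ((Real.log (1 / δ) : ℝ) : EReal) ≤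
        ((∫⁻ θ, (optLogWealth (fun i : Fin n => f θ (X i ω)) (∫ ω', f θ (X 0 ω') ∂μ)).toENNReal
            ∂(P fun i : Fin n => X i ω) : ℝ≥0∞) : EReal)
          - ((klDiv (P fun i : Fin n => X i ω) P₀ : ℝ≥0∞) : EReal)
          - ((Real.log (Real.sqrt Real.pi * Real.Gamma ((n : ℝ) + 1)
              / Real.Gamma ((n : ℝ) + 1 / 2)) : ℝ) : EReal)}
      ≤ ENNReal.ofReal δ := by
  set m : Θ → ℝ := fun θ => ∫ ω', f θ (X 0 ω') ∂μ with hmdef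
  have hfX : ∀ θ i, Measurable fun ω => f θ (X i ω) := fun θ i =>
    (hf.comp measurable_prodMk_left).comp (hX i)
  have hm : Measurable m :=
    (StronglyMeasurable.integral_prod_right (f := fun (θ : Θ) (ω : Ω) => f θ (X 0 ω))
      (hf.comp (measurable_fst.prodMk ((hX 0).comp measurable_snd))).stronglyMeasurable).measurable
  have hm01 : ∀ θ, m θ ∈ Set.Icc (0 : ℝ) 1 := fun θ => by
    refine ⟨integral_nonneg fun ω => (hf01 θ _).1, ?_⟩
    have hint : Integrable (fun ω => f θ (X 0 ω)) μ :=
      Integrable.of_mem_Icc 0 1 (hfX θ 0).aemeasurable (ae_of_all _ fun ω => hf01 θ _)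
    simpa using integral_mono hint (integrable_const 1) fun ω => (hf01 θ _).2
  have hmi : ∀ θ i, ∫ ω, f θ (X i ω) ∂μ = m θ := fun θ i =>
    ((hident i).comp (hf.comp measurable_prodMk_left : Measurable (f θ))).integral_eq
  have : IsProbabilityMeasure (betaMeasure (1 / 2) (1 / 2)) :=
    isProbabilityMeasureBeta (by norm_num) (by norm_num)
  -- The Beta law lives on `ℝ`; clamping makes the mean bound hold for every `z` and changes nothing
  -- almost everywhere.
  let proj : ℝ → ℝ := fun t => max 0 (min t 1)
  have hproj : ∀ t, proj t ∈ Set.Icc (0 : ℝ) 1 := fun t => ⟨le_max_left _ _, by simp [proj]⟩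
  have hprojm : Measurable proj := by fun_prop
  have hproj_eq : ∀ t ∈ Set.Icc (0 : ℝ) 1, proj t = t := fun t ht => by simp [proj, ht.1, ht.2]
  let g : Θ × ℝ → 𝒳 → ℝ≥0∞ := fun z x => portfolioFactor (m z.1) (f z.1 x) (proj z.2)
  have hg : Measurable (Function.uncurry g) :=
    measurable_portfolioFactor (hm.comp (measurable_fst.comp measurable_fst))
      (hf.comp ((measurable_fst.comp measurable_fst).prodMk measurable_snd))
      (hprojm.comp (measurable_snd.comp measurable_fst))
  have hg1 : ∀ z i, ∫⁻ ω, g z (X i ω) ∂μ ≤ 1 := fun z i => by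
    have h := lintegral_portfolioFactor_le_one (μ := μ) (hfX z.1 i) (fun ω => hf01 z.1 _)
      (hproj z.2)
    rwa [hmi] at h
  set ρ := P₀.prod (betaMeasure (1 / 2) (1 / 2))
  have hville := mul_measure_exists_le_mixtureWealth_le_one hX hindep ρ hg hg1
    (ENNReal.ofReal (1 / δ))
  have hδ' : ENNReal.ofReal (1 / δ) = (ENNReal.ofReal δ)⁻¹ := by
    rw [one_div, ENNReal.ofReal_inv_of_pos hδ0]
  have hδne : ENNReal.ofReal δ ≠ 0 := (ENNReal.ofReal_pos.2 hδ0).ne'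
  calc _ ≤ μ {ω | ∃ n, ENNReal.ofReal (1 / δ) ≤ mixtureWealth ρ g X n ω} := ?_
    _ ≤ ENNReal.ofReal δ := by
      rw [hδ'] at hville ⊢
      rwa [mul_comm, ← div_eq_mul_inv, ENNReal.div_le_iff hδne ENNReal.ofReal_ne_top,
        one_mul] at hville
  -- Inclusion of events, outcome by outcome; the left event need not be measurable.
  refine measure_mono ?_
  rintro ω ⟨n, P, hP, h⟩
  refine ⟨n, ?_⟩
  let W : Θ → ℝ≥0∞ := fun θ =>
    ∫⁻ t, ∏ i ∈ Finset.range n, g (θ, t) (X i ω) ∂betaMeasure (1 / 2) (1 / 2)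
  have hprodm : Measurable fun z : Θ × ℝ => ∏ i ∈ Finset.range n, g z (X i ω) :=
    Finset.measurable_prod _ fun i _ => hg.comp measurable_prodMk_right
  have hWm : Measurable W := Measurable.lintegral_prod_right' hprodm
  have hM : mixtureWealth ρ g X n ω = ∫⁻ θ, W θ ∂P₀ :=
    lintegral_prod _ hprodm.aemeasurable
  have hopt : ∀ θ, optLogWealth (fun i : Fin n => f θ (X i ω)) (m θ) ≤
      ENNReal.log (ENNReal.ofReal (mixtureRegret n) * W θ) := fun θ => by
    refine (optLogWealth_le_log_lintegral (fun i => hf01 θ _) (hm01 θ)).trans_eq ?_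
    congr 2
    refine lintegral_congr_ae ?_
    filter_upwards [ae_betaMeasure_mem_Icc (1 / 2) (1 / 2)] with t ht
    simp only [g, hproj_eq t ht, Finset.prod_range]
  -- The zero bet gives nonnegative optimal log-wealth, so `toENNReal` truncates no logarithm in
  -- Donsker-Varadhan.
  have hW1 : ∀ θ, 1 ≤ ENNReal.ofReal (mixtureRegret n) * W θ := fun θ =>
    ENNReal.zero_le_log_iff.1 ((optLogWealth_nonneg _ _).trans (hopt θ))
  have hconst : ∫⁻ θ, ENNReal.ofReal (mixtureRegret n) * W θ ∂P₀ =
      ENNReal.ofReal (mixtureRegret n) * mixtureWealth ρ g X n ω := by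
    rw [lintegral_const_mul _ hWm, hM]
  have hone : 1 ≤ ENNReal.ofReal (mixtureRegret n) * mixtureWealth ρ g X n ω := by
    rw [← hconst]
    simpa using lintegral_mono (μ := P₀) hW1
  have hfinal := exp_le_of_le_sub_sub_log (mixtureRegret_pos n) h hone fun hne => by
    rw [← hconst] at hne ⊢
    refine le_trans (lintegral_mono fun θ => EReal.toENNReal_le_toENNReal (hopt θ)) ?_
    exact lintegral_log_le_klDiv_add (hWm.const_mul _) hW1 hne
  rwa [Real.exp_log (by positivity)] at hfinal
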